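/- For $p\in[1,\infty)$ let $X_p(0,1)=L^p(0,1)$ (with Lebesgue measure), and let $X_\infty(0,1)$ be the space of continuous $1$-periodic functions on $\mathbb R$ with the uniform norm; functions are real-valued or complex-valued, and linear spans are taken over the same field. A set $F\subset X_p(0,1)$ is total if its linear span is dense in $X_p(0,1)$. A set $\Lambda\subset\mathbb N=\{0,1,2,\dots\}$ is called a $[-1,1]$-Müntz–Szász sequence if $$0\in\Lambda,\qquad \sum_{\lambda\in\Lambda,\ \lambda\text{ even},\ \lambda\neq0}\frac1\lambda=+\infty\qquad\text{and}\qquad \sum_{\lambda\in\Lambda,\ \lambda\text{ odd}}\frac1\lambda=+\infty .$$ **Theorem.** Let $p\in[1,\infty]$, let $\theta_1,\theta_2\in\mathbb R$ be such that $\theta_1-\theta_2$ is irrational, and let $\Lambda,\Lambda'\subset\mathbb N$. If $\Lambda$ and $\Lambda'$ are $[-1,1]$-Müntz–Szász sequences, then the system $$\{\cos^{\lambda}2\pi(t-\theta_1):\lambda\in\Lambda\}\cup\{\cos^{\lambda'}2\pi(t-\theta_2):\lambda'\in\Lambda'\}$$ is contained in $X_p(0,1)$ and is total in $X_p(0,1)$.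 -/

import Mathlib

open MeasureTheory Set
open scoped ENNReal

/-- `Λ ⊆ ℕ` is a `[-1, 1]`-Müntz–Szász sequence: `0 ∈ Λ`, and both the sum of `1 / n` over the
nonzero even `n ∈ Λ` and the sum of `1 / n` over the odd `n ∈ Λ` diverge. The terms are positive,
so divergence to `+∞` is the failure of summability. -/
structure IsMuntzSzaszSymm (Λ : Set ℕ) : Prop where
  zero_mem : 0 ∈ Λ
  even_diverges : ¬ Summable (fun n : {n : ℕ // n ∈ Λ ∧ Even n ∧ n ≠ 0} => (1 : ℝ) / (n : ℕ))
  odd_diverges : ¬ Summable (fun n : {n : ℕ // n ∈ Λ ∧ Odd n} => (1 : ℝ) / (n : ℕ))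

/-- The function `t ↦ cos ^ n (2 π (t - θ))` on `ℝ`, with values in `𝕜` (which is `ℝ` or `ℂ`). -/
noncomputable def cosPow (𝕜 : Type*) [RCLike 𝕜] (θ : ℝ) (n : ℕ) : ℝ → 𝕜 :=
  fun t => ((Real.cos (2 * Real.pi * (t - θ)) ^ n : ℝ) : 𝕜)

/-- Lebesgue measure on the interval `(0, 1)`. -/
noncomputable def volUnit : Measure ℝ := volume.restrict (Ioo (0 : ℝ) 1)

/-- A family `F` of functions is total in `X_p(0, 1)`: its members belong to `X_p(0, 1)` and its
linear span over `𝕜` is dense there. For `p < ∞`, `X_p(0, 1)` is `L^p(0, 1)`; for `p = ∞` it is the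
space of continuous `1`-periodic functions with the uniform norm, that is, of continuous functions
on the circle `ℝ / ℤ`. -/
def IsTotalInX {𝕜 : Type*} [RCLike 𝕜] (p : ℝ≥0∞) [Fact (1 ≤ p)] (F : Set (ℝ → 𝕜)) : Prop :=
  (p ≠ ∞ →
    (∀ f ∈ F, MemLp f p volUnit) ∧
    Dense (Submodule.span 𝕜 {g : Lp 𝕜 p volUnit | ∃ f ∈ F, g =ᵐ[volUnit] f} :
      Set (Lp 𝕜 p volUnit))) ∧
  (p = ∞ →
    (∀ f ∈ F, Continuous f ∧ Function.Periodic f 1) ∧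
    Dense (Submodule.span 𝕜
      {g : C(UnitAddCircle, 𝕜) | ∃ f ∈ F, ∀ t : ℝ, g (t : UnitAddCircle) = f t} :
      Set C(UnitAddCircle, 𝕜)))

/-! By Müntz–Szász on `[-1, 1]`, every power of `cos 2π(t - θ)` is a uniform limit of combinations
of the powers with exponent in `Λ`; hence, through Chebyshev polynomials, so is every `cos 2πk(t -
θ)`. For `k ≠ 0` the cosines with phases `θ₁` and `θ₂` span `cos 2πkt` and `sin 2πkt`, since the
determinant `sin 2πk(θ₁ - θ₂)` is nonzero by irrationality. Fejér–Weierstrass density then gives `p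
= ∞`. For finite `p`, uniform density passes to `L^p` because continuous functions are dense there.
-/

/-! ### Müntz approximation of powers -/

/-- A differential form of von Golitschek's argument. If `P` is the error for `s`, the new error `Q`
solves `m Q - x Q' = (m - q) P` with `Q 0 = Q 1 = 0`. At an interior maximum of `|Q|` one has `Q' =
0`, so `Q = (1 - q / m) P` there: each new exponent contributes one factor. -/
theorem exists_abs_pow_sub_sum_le_prod {q : ℕ} (hq : 0 < q) (s : Finset ℕ) (hs : ∀ n ∈ s, q < n) :
    ∃ a : ℕ → ℝ, ∀ x ∈ Icc (0 : ℝ) 1,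
      |x ^ q - ∑ n ∈ s, a n * x ^ n| ≤ ∏ n ∈ s, (1 - (q : ℝ) / n) := by
  induction s using Finset.induction_on with
  | empty =>
    refine ⟨0, fun x hx => ?_⟩
    simpa [abs_of_nonneg hx.1] using pow_le_one₀ hx.1 hx.2
  | insert m s hm ih =>
    obtain ⟨a, ha⟩ := ih fun n hn => hs n (Finset.mem_insert_of_mem hn)
    have hqm : q < m := hs m (Finset.mem_insert_self _ _)
    have hqm' : (q : ℝ) < m := by exact_mod_cast hqm
    have hm0 : (0 : ℝ) < m := by exact_mod_cast hq.trans hqm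
    -- The operator `m - x d/dx` multiplies `x ^ n` by `m - n` and kills `x ^ m`. So `b` is forced
    -- by the equation, and the free coefficient `c` is spent on `Q 1 = 0`.
    set b : ℕ → ℝ := fun n => a n * ((m - q) / (m - n)) with hb
    set c : ℝ := 1 - ∑ n ∈ s, b n with hc
    set Q : ℝ → ℝ := fun x => x ^ q - ∑ n ∈ s, b n * x ^ n - c * x ^ m with hQ
    have hder : ∀ x, HasDerivAt Q (q * x ^ (q - 1) - ∑ n ∈ s, b n * (n * x ^ (n - 1))
        - c * (m * x ^ (m - 1))) x := fun x =>
      ((hasDerivAt_pow q x).sub (HasDerivAt.fun_sum fun n _ =>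
        (hasDerivAt_pow n x).const_mul (b n))).sub ((hasDerivAt_pow m x).const_mul c)
    have hpow : ∀ n : ℕ, ∀ x : ℝ, x * (n * x ^ (n - 1)) = n * x ^ n := by
      intro n x
      rcases n with _ | n
      · simp
      · simp [pow_succ]; ring
    have hode : ∀ x, m * Q x - x * (q * x ^ (q - 1) - ∑ n ∈ s, b n * (n * x ^ (n - 1))
        - c * (m * x ^ (m - 1))) = (m - q) * (x ^ q - ∑ n ∈ s, a n * x ^ n) := by
      intro x
      have h1 : x * (q * x ^ (q - 1) - ∑ n ∈ s, b n * (n * x ^ (n - 1))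
          - c * (m * x ^ (m - 1))) = q * x ^ q - ∑ n ∈ s, b n * (n * x ^ n) - c * (m * x ^ m) := by
        rw [mul_sub, mul_sub, hpow, Finset.mul_sum, mul_left_comm, hpow]
        congr 2
        exact Finset.sum_congr rfl fun n _ => by rw [mul_left_comm, hpow]
      have h2 : (m : ℝ) * ∑ n ∈ s, b n * x ^ n - ∑ n ∈ s, b n * (n * x ^ n)
          = (m - q) * ∑ n ∈ s, a n * x ^ n := by
        rw [Finset.mul_sum, Finset.mul_sum, ← Finset.sum_sub_distrib]
        refine Finset.sum_congr rfl fun n hn => ?_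
        have hne : (m : ℝ) - n ≠ 0 :=
          sub_ne_zero.2 fun h => hm (by rwa [Nat.cast_injective h])
        simp only [hb]
        field_simp
      rw [h1]
      simp only [hQ]
      linear_combination -h2
    have hQc : Continuous fun x => |Q x| :=
      (continuous_iff_continuousAt.2 fun x => (hder x).continuousAt).abs
    have hprod : ∏ n ∈ insert m s, (1 - (q : ℝ) / n) =
        (1 - (q : ℝ) / m) * ∏ n ∈ s, (1 - (q : ℝ) / n) := Finset.prod_insert hm
    have hnn : ∀ n ∈ insert m s, 0 ≤ 1 - (q : ℝ) / n := fun n hn => by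
      have : (q : ℝ) < n := by exact_mod_cast hs n hn
      have := div_le_one_of_le₀ this.le (Nat.cast_nonneg n)
      linarith
    have hpos : 0 ≤ ∏ n ∈ insert m s, (1 - (q : ℝ) / n) := Finset.prod_nonneg hnn
    obtain ⟨x₀, hx₀, hmax⟩ := isCompact_Icc.exists_isMaxOn (nonempty_Icc.2 zero_le_one)
      hQc.continuousOn (s := Icc (0 : ℝ) 1)
    have hbound : |Q x₀| ≤ ∏ n ∈ insert m s, (1 - (q : ℝ) / n) := by
      rcases hx₀.1.eq_or_lt with h0 | h0
      · have : Q x₀ = 0 := by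
          subst h0
          have : ∑ n ∈ s, b n * (0 : ℝ) ^ n = 0 := Finset.sum_eq_zero fun n hn => by
            have := hs n (Finset.mem_insert_of_mem hn)
            simp [show n ≠ 0 by omega]
          simp [hQ, this, hq.ne', show m ≠ 0 by omega]
        rwa [this, abs_zero]
      rcases hx₀.2.eq_or_lt with h1 | h1
      · have : Q x₀ = 0 := by simp [hQ, h1, hc]
        rwa [this, abs_zero]
      have hnhds : Icc (0 : ℝ) 1 ∈ nhds x₀ := Icc_mem_nhds h0 h1
      have hloc : IsLocalMax (fun x => |Q x|) x₀ := hmax.isLocalMax hnhds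
      have hext : IsLocalExtr Q x₀ := by
        rcases le_total 0 (Q x₀) with h | h
        · right
          filter_upwards [hloc] with x hx
          exact (le_abs_self _).trans (hx.trans_eq (abs_of_nonneg h))
        · left
          filter_upwards [hloc] with x hx
          have := (neg_le_abs (Q x)).trans (hx.trans_eq (abs_of_nonpos h))
          linarith
      have hode' := hode x₀
      rw [hext.hasDerivAt_eq_zero (hder x₀), mul_zero, sub_zero] at hode'
      have hQx : Q x₀ = (1 - q / m) * (x₀ ^ q - ∑ n ∈ s, a n * x₀ ^ n) := by
        field_simp
        linear_combination hode'
      rw [hQx, hprod, abs_mul, abs_of_nonneg (hnn m (Finset.mem_insert_self _ _))]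
      exact mul_le_mul_of_nonneg_left (ha x₀ hx₀) (hnn m (Finset.mem_insert_self _ _))
    refine ⟨fun n => if n = m then c else b n, fun x hx => ?_⟩
    have hsum : ∑ n ∈ insert m s, (if n = m then c else b n) * x ^ n =
        c * x ^ m + ∑ n ∈ s, b n * x ^ n := by
      rw [Finset.sum_insert hm, if_pos rfl]
      congr 1
      exact Finset.sum_congr rfl fun n hn => by rw [if_neg (ne_of_mem_of_not_mem hn hm)]
    rw [hsum, show x ^ q - (c * x ^ m + ∑ n ∈ s, b n * x ^ n) = Q x by simp only [hQ]; ring]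
    exact (hmax hx).trans hbound

/-- The error is an even or odd function, so its absolute value is even. This is why each parity
needs its own divergent series. -/
theorem abs_pow_sub_sum_le_of_parity {q : ℕ} {s : Finset ℕ} (hs : ∀ n ∈ s, Even n ↔ Even q)
    {a : ℕ → ℝ} {ε : ℝ} (h : ∀ x ∈ Icc (0 : ℝ) 1, |x ^ q - ∑ n ∈ s, a n * x ^ n| ≤ ε)
    {x : ℝ} (hx : |x| ≤ 1) : |x ^ q - ∑ n ∈ s, a n * x ^ n| ≤ ε := by
  have hx' := h |x| ⟨abs_nonneg x, hx⟩
  rcases le_total 0 x with h0 | h0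
  · rwa [abs_of_nonneg h0] at hx'
  rw [abs_of_nonpos h0] at hx'
  rcases Nat.even_or_odd q with hq | hq
  · rw [hq.neg_pow, Finset.sum_congr rfl fun n hn => by rw [((hs n hn).2 hq).neg_pow]] at hx'
    exact hx'
  · have hodd : ∀ n ∈ s, Odd n := fun n hn =>
      Nat.not_even_iff_odd.1 fun he => Nat.not_even_iff_odd.2 hq ((hs n hn).1 he)
    rw [hq.neg_pow, Finset.sum_congr rfl fun n hn => by
      rw [(hodd n hn).neg_pow, mul_neg], Finset.sum_neg_distrib, ← neg_sub', abs_neg] at hx'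
    exact hx'

theorem exists_prod_one_sub_div_lt {S : Set ℕ}
    (hS : ¬ Summable fun n : S => (1 : ℝ) / (n : ℕ)) {q : ℕ} (hq : 0 < q) {ε : ℝ} (hε : 0 < ε) :
    ∃ s : Finset ℕ, (∀ n ∈ s, n ∈ S ∧ q < n) ∧ ∏ n ∈ s, (1 - (q : ℝ) / n) < ε := by
  classical
  -- `C` bounds what is lost by discarding the exponents `n ≤ q`.
  set C : ℝ := ∑ n ∈ Finset.range (q + 1), (1 : ℝ) / n with hC
  obtain ⟨u, hu⟩ : ∃ u : Finset S, C + |Real.log ε| + 1 < ∑ n ∈ u, (1 : ℝ) / (n : ℕ) := by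
    by_contra! hcon
    exact hS (summable_of_sum_le (fun n => by positivity) hcon)
  set v : Finset ℕ := u.map (Function.Embedding.subtype _) with hv
  have hvsum : ∑ n ∈ u, (1 : ℝ) / (n : ℕ) = ∑ n ∈ v, (1 : ℝ) / n := by
    rw [hv, Finset.sum_map]; rfl
  set s : Finset ℕ := v.filter (q < ·) with hs
  have hsum : |Real.log ε| + 1 < ∑ n ∈ s, (1 : ℝ) / n := by
    have h1 := Finset.sum_filter_add_sum_filter_not v (q < ·) fun n : ℕ => (1 : ℝ) / n
    have h2 : ∑ n ∈ v with ¬ q < n, (1 : ℝ) / n ≤ C :=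
      Finset.sum_le_sum_of_subset_of_nonneg
        (fun n hn => by
          have := (Finset.mem_filter.1 hn).2
          exact Finset.mem_range.2 (by omega))
        fun n _ _ => by positivity
    rw [hvsum] at hu
    linarith
  refine ⟨s, fun n hn => ?_, ?_⟩
  · obtain ⟨hnv, hqn⟩ := Finset.mem_filter.1 hn
    obtain ⟨y, -, rfl⟩ := Finset.mem_map.1 hnv
    exact ⟨y.2, hqn⟩
  -- As `q ≥ 1`, `1 - q / n ≤ 1 - 1 / n ≤ exp (-1 / n)`.
  calc ∏ n ∈ s, (1 - (q : ℝ) / n) ≤ ∏ n ∈ s, Real.exp (-((1 : ℝ) / n)) := by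
        refine Finset.prod_le_prod (fun n hn => ?_) fun n hn => ?_
        · have : (q : ℝ) ≤ n := by exact_mod_cast (Finset.mem_filter.1 hn).2.le
          have := div_le_one_of_le₀ this (Nat.cast_nonneg n)
          linarith
        · have h1 : (1 : ℝ) / n ≤ q / n :=
            div_le_div_of_nonneg_right (by exact_mod_cast hq) (Nat.cast_nonneg n)
          have h2 := Real.add_one_le_exp (-((1 : ℝ) / n))
          linarith
    _ = Real.exp (-∑ n ∈ s, (1 : ℝ) / n) := by rw [← Real.exp_sum, Finset.sum_neg_distrib]
    _ < Real.exp (Real.log ε) := by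
        refine Real.exp_lt_exp.2 ?_
        have := neg_abs_le (Real.log ε)
        linarith
    _ = ε := Real.exp_log hε

theorem IsMuntzSzaszSymm.pow_mem_topologicalClosure_span {Λ : Set ℕ} (hΛ : IsMuntzSzaszSymm Λ)
    {X : Type*} [TopologicalSpace X] [CompactSpace X] (c : C(X, ℝ)) (hc : ∀ x, |c x| ≤ 1) (q : ℕ) :
    c ^ q ∈ (Submodule.span ℝ ((fun n => c ^ n) '' Λ)).topologicalClosure := by
  rcases Nat.eq_zero_or_pos q with rfl | hq
  · exact Submodule.le_topologicalClosure _ (Submodule.subset_span ⟨0, hΛ.zero_mem, rfl⟩)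
  have key : ∀ ε > 0, ∃ s : Finset ℕ, (∀ n ∈ s, n ∈ Λ ∧ (Even n ↔ Even q) ∧ q < n) ∧
      ∏ n ∈ s, (1 - (q : ℝ) / n) < ε := by
    intro ε hε
    rcases Nat.even_or_odd q with h | h
    · obtain ⟨s, hs, hlt⟩ :=
        exists_prod_one_sub_div_lt (S := {n | n ∈ Λ ∧ Even n ∧ n ≠ 0}) hΛ.even_diverges hq hε
      exact ⟨s, fun n hn => ⟨(hs n hn).1.1, iff_of_true (hs n hn).1.2.1 h, (hs n hn).2⟩, hlt⟩
    · obtain ⟨s, hs, hlt⟩ :=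
        exists_prod_one_sub_div_lt (S := {n | n ∈ Λ ∧ Odd n}) hΛ.odd_diverges hq hε
      exact ⟨s, fun n hn => ⟨(hs n hn).1.1, iff_of_false (Nat.not_even_iff_odd.2 (hs n hn).1.2)
        (Nat.not_even_iff_odd.2 h), (hs n hn).2⟩, hlt⟩
  refine Metric.mem_closure_iff.2 fun ε hε => ?_
  obtain ⟨s, hs, hlt⟩ := key ε hε
  obtain ⟨a, ha⟩ := exists_abs_pow_sub_sum_le_prod hq s fun n hn => (hs n hn).2.2
  refine ⟨∑ n ∈ s, a n • c ^ n, Submodule.sum_mem _ fun n hn =>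
    Submodule.smul_mem _ _ (Submodule.subset_span ⟨n, (hs n hn).1, rfl⟩), ?_⟩
  refine (ContinuousMap.dist_lt_iff hε).2 fun x => ?_
  have := abs_pow_sub_sum_le_of_parity (fun n hn => (hs n hn).2.1) ha (hc x)
  simpa [Real.dist_eq, ContinuousMap.sum_apply] using this.trans_lt hlt

/-! ### Shifted cosines and uniform density on the circle -/

/-- The function `x ↦ cos (2 π k (x - θ))` on the circle `ℝ / ℤ`. -/
noncomputable def circleCos (θ : ℝ) (k : ℤ) : C(UnitAddCircle, ℝ) where
  toFun x := (fourier k (x - (θ : UnitAddCircle))).re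

@[simp]
theorem circleCos_coe (θ : ℝ) (k : ℤ) (t : ℝ) :
    circleCos θ k (t : UnitAddCircle) = Real.cos (2 * Real.pi * k * (t - θ)) := by
  rw [← Complex.exp_ofReal_mul_I_re]
  change (fourier k ((t - θ : ℝ) : UnitAddCircle)).re = _
  rw [fourier_coe_apply]
  congr 2
  push_cast
  ring

theorem aeval_chebyshev_circleCos (θ : ℝ) (k : ℤ) :
    Polynomial.aeval (circleCos θ 1) (Polynomial.Chebyshev.T ℝ k) = circleCos θ k := by
  ext x
  induction x using QuotientAddGroup.induction_on with
  | H t =>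
    change ContinuousMap.evalAlgHom ℝ ℝ (t : UnitAddCircle) _ = _
    rw [← Polynomial.aeval_algHom_apply]
    simp only [ContinuousMap.evalAlgHom_apply, circleCos_coe, Polynomial.coe_aeval_eq_eval,
      Polynomial.Chebyshev.T_real_cos]
    congr 1
    push_cast
    ring

theorem IsMuntzSzaszSymm.circleCos_mem {Λ : Set ℕ} (hΛ : IsMuntzSzaszSymm Λ) (θ : ℝ) (k : ℤ) :
    circleCos θ k ∈
      (Submodule.span ℝ ((fun n => circleCos θ 1 ^ n) '' Λ)).topologicalClosure := by
  set V := (Submodule.span ℝ ((fun n => circleCos θ 1 ^ n) '' Λ)).topologicalClosure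
  rw [← aeval_chebyshev_circleCos, Polynomial.aeval_eq_sum_range]
  refine V.sum_mem fun q _ => V.smul_mem _ ?_
  refine hΛ.pow_mem_topologicalClosure_span _ (fun x => ?_) q
  induction x using QuotientAddGroup.induction_on with
  | H t => rw [circleCos_coe]; exact Real.abs_cos_le_one _

theorem sin_two_pi_int_mul_ne_zero {α : ℝ} (hα : Irrational α) {k : ℤ} (hk : k ≠ 0) :
    Real.sin (2 * Real.pi * k * α) ≠ 0 := by
  rw [Ne, Real.sin_eq_zero_iff]
  rintro ⟨n, hn⟩
  have h : (n : ℝ) = 2 * k * α :=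
    mul_right_cancel₀ Real.pi_ne_zero (hn.trans (by ring))
  refine (hα.intCast_mul (m := 2 * k) (by simpa using hk)).ne_int n ?_
  rw [h]
  push_cast
  ring

theorem re_fourier_coe (k : ℤ) (t : ℝ) :
    (fourier k (t : UnitAddCircle)).re = Real.cos (2 * Real.pi * k * t) := by
  rw [← Complex.exp_ofReal_mul_I_re, fourier_coe_apply]
  congr 2
  push_cast
  ring

theorem im_fourier_coe (k : ℤ) (t : ℝ) :
    (fourier k (t : UnitAddCircle)).im = Real.sin (2 * Real.pi * k * t) := by
  rw [← Complex.exp_ofReal_mul_I_im, fourier_coe_apply]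
  congr 2
  push_cast
  ring

/-- The real part as a map of spaces of continuous functions. -/
noncomputable def reContinuousMap (X : Type*) [TopologicalSpace X] [CompactSpace X] :
    C(X, ℂ) →L[ℝ] C(X, ℝ) :=
  Complex.reCLM.compLeftContinuous ℝ X

/-- The imaginary part as a map of spaces of continuous functions. -/
noncomputable def imContinuousMap (X : Type*) [TopologicalSpace X] [CompactSpace X] :
    C(X, ℂ) →L[ℝ] C(X, ℝ) :=
  Complex.imCLM.compLeftContinuous ℝ X

@[simp]
theorem reContinuousMap_apply {X : Type*} [TopologicalSpace X] [CompactSpace X] (f : C(X, ℂ))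
    (x : X) : reContinuousMap X f x = (f x).re := rfl

@[simp]
theorem imContinuousMap_apply {X : Type*} [TopologicalSpace X] [CompactSpace X] (f : C(X, ℂ))
    (x : X) : imContinuousMap X f x = (f x).im := rfl

/-- Real and imaginary parts of complex trigonometric polynomials stay in `V`; a real function is
the real part of a limit of these. -/
theorem eq_top_of_re_im_fourier_mem {V : Submodule ℝ C(UnitAddCircle, ℝ)}
    (hV : IsClosed (V : Set C(UnitAddCircle, ℝ)))
    (hre : ∀ k : ℤ, reContinuousMap UnitAddCircle (fourier k) ∈ V)
    (him : ∀ k : ℤ, imContinuousMap UnitAddCircle (fourier k) ∈ V) : V = ⊤ := by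
  have hspan : ∀ f ∈ Submodule.span ℂ (range (@fourier 1)),
      reContinuousMap UnitAddCircle f ∈ V ∧ imContinuousMap UnitAddCircle f ∈ V := by
    intro f hf
    induction hf using Submodule.span_induction with
    | mem f hf =>
      obtain ⟨k, rfl⟩ := hf
      exact ⟨hre k, him k⟩
    | zero => simp
    | add f g _ _ hf hg =>
      rw [map_add, map_add]
      exact ⟨V.add_mem hf.1 hg.1, V.add_mem hf.2 hg.2⟩
    | smul a f _ hf =>
      have h1 : reContinuousMap UnitAddCircle (a • f) =
          a.re • reContinuousMap UnitAddCircle f - a.im • imContinuousMap UnitAddCircle f := by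
        ext x; simp
      have h2 : imContinuousMap UnitAddCircle (a • f) =
          a.re • imContinuousMap UnitAddCircle f + a.im • reContinuousMap UnitAddCircle f := by
        ext x; simp
      rw [h1, h2]
      exact ⟨V.sub_mem (V.smul_mem _ hf.1) (V.smul_mem _ hf.2),
        V.add_mem (V.smul_mem _ hf.2) (V.smul_mem _ hf.1)⟩
  have hall : ∀ f : C(UnitAddCircle, ℂ), reContinuousMap UnitAddCircle f ∈ V := by
    intro f
    have hf : f ∈ closure (Submodule.span ℂ (range (@fourier 1)) : Set C(UnitAddCircle, ℂ)) := by
      rw [← Submodule.topologicalClosure_coe, span_fourier_closure_eq_top]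
      trivial
    have := map_mem_closure (reContinuousMap UnitAddCircle).continuous hf
      (fun g hg => (hspan g hg).1 : MapsTo _ _ (V : Set C(UnitAddCircle, ℝ)))
    rwa [hV.closure_eq] at this
  refine eq_top_iff.2 fun g _ => ?_
  have := hall (Complex.ofRealCLM.compLeftContinuous ℝ UnitAddCircle g)
  convert this
  ext x
  simp

theorem topologicalClosure_span_circleCos_pow_eq_top {θ₁ θ₂ : ℝ} (hθ : Irrational (θ₁ - θ₂))
    {Λ Λ' : Set ℕ} (hΛ : IsMuntzSzaszSymm Λ) (hΛ' : IsMuntzSzaszSymm Λ') :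
    (Submodule.span ℝ ((fun n => circleCos θ₁ 1 ^ n) '' Λ ∪
      (fun n => circleCos θ₂ 1 ^ n) '' Λ')).topologicalClosure = ⊤ := by
  set V := (Submodule.span ℝ ((fun n => circleCos θ₁ 1 ^ n) '' Λ ∪
      (fun n => circleCos θ₂ 1 ^ n) '' Λ')).topologicalClosure with hV
  have h₁ : ∀ k, circleCos θ₁ k ∈ V := fun k =>
    Submodule.topologicalClosure_mono (Submodule.span_mono subset_union_left)
      (hΛ.circleCos_mem θ₁ k)
  have h₂ : ∀ k, circleCos θ₂ k ∈ V := fun k =>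
    Submodule.topologicalClosure_mono (Submodule.span_mono subset_union_right)
      (hΛ'.circleCos_mem θ₂ k)
  refine eq_top_of_re_im_fourier_mem (Submodule.isClosed_topologicalClosure _)
    (fun k => ?_) fun k => ?_
  · rcases eq_or_ne k 0 with rfl | hk
    -- The determinant vanishes at `k = 0`, but there the constant `1` is itself a shifted cosine.
    · convert h₁ 0
      ext x
      simp [circleCos]
    have hne := sin_two_pi_int_mul_ne_zero hθ hk
    have : Real.sin (2 * Real.pi * k * (θ₁ - θ₂)) • reContinuousMap UnitAddCircle (fourier k) =
        Real.sin (2 * Real.pi * k * θ₁) • circleCos θ₂ k -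
          Real.sin (2 * Real.pi * k * θ₂) • circleCos θ₁ k := by
      ext x
      induction x using QuotientAddGroup.induction_on with
      | H t =>
        simp only [ContinuousMap.smul_apply, ContinuousMap.sub_apply, reContinuousMap_apply,
          re_fourier_coe, circleCos_coe, smul_eq_mul, mul_sub, Real.sin_sub, Real.cos_sub]
        ring
    rw [← V.smul_mem_iff hne, this]
    exact V.sub_mem (V.smul_mem _ (h₂ k)) (V.smul_mem _ (h₁ k))
  · rcases eq_or_ne k 0 with rfl | hk
    · convert V.zero_mem
      ext x
      simp
    have hne := sin_two_pi_int_mul_ne_zero hθ hk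
    have : Real.sin (2 * Real.pi * k * (θ₁ - θ₂)) • imContinuousMap UnitAddCircle (fourier k) =
        Real.cos (2 * Real.pi * k * θ₂) • circleCos θ₁ k -
          Real.cos (2 * Real.pi * k * θ₁) • circleCos θ₂ k := by
      ext x
      induction x using QuotientAddGroup.induction_on with
      | H t =>
        simp only [ContinuousMap.smul_apply, ContinuousMap.sub_apply, imContinuousMap_apply,
          im_fourier_coe, circleCos_coe, smul_eq_mul, mul_sub, Real.sin_sub, Real.cos_sub]
        ring
    rw [← V.smul_mem_iff hne, this]
    exact V.sub_mem (V.smul_mem _ (h₁ k)) (V.smul_mem _ (h₂ k))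

/-! ### Passage to the scalars `𝕜` and to `L^p` -/

theorem dense_span_of_ofReal_mem {𝕜 : Type*} [RCLike 𝕜] {X : Type*} [TopologicalSpace X]
    [CompactSpace X] {S : Set C(X, ℝ)} (hS : (Submodule.span ℝ S).topologicalClosure = ⊤)
    {G : Set C(X, 𝕜)} (hG : ∀ g ∈ S, RCLike.ofRealCLM.compLeftContinuous ℝ X g ∈ G) :
    Dense (Submodule.span 𝕜 G : Set C(X, 𝕜)) := by
  set W := (Submodule.span 𝕜 G).topologicalClosure with hW
  set ι : C(X, ℝ) →L[ℝ] C(X, 𝕜) := RCLike.ofRealCLM.compLeftContinuous ℝ X with hι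
  have hreal : ∀ g, ι g ∈ W := by
    intro g
    have hle : (Submodule.span ℝ S).topologicalClosure ≤
        (W.restrictScalars ℝ).comap (ι : C(X, ℝ) →ₗ[ℝ] C(X, 𝕜)) := by
      refine Submodule.topologicalClosure_minimal _ (Submodule.span_le.2 fun g hg => ?_) ?_
      · exact Submodule.le_topologicalClosure _ (Submodule.subset_span (hG g hg))
      · exact (Submodule.isClosed_topologicalClosure (Submodule.span 𝕜 G)).preimage ι.continuous
    exact hle (hS ▸ Submodule.mem_top)
  refine Submodule.dense_iff_topologicalClosure_eq_top.2 (eq_top_iff.2 fun f _ => ?_)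
  have : f = ι (RCLike.reCLM.compLeftContinuous ℝ X f) +
      (RCLike.I : 𝕜) • ι (RCLike.imCLM.compLeftContinuous ℝ X f) := by
    ext x
    simp [hι, mul_comm (RCLike.I : 𝕜), RCLike.re_add_im]
  rw [this]
  exact W.add_mem (hreal _) (W.smul_mem _ (hreal _))

theorem measurePreserving_coe_volUnit :
    MeasurePreserving ((↑) : ℝ → UnitAddCircle) volUnit volume := by
  have := UnitAddCircle.measurePreserving_mk 0
  rwa [zero_add, Measure.restrict_congr_set Ioo_ae_eq_Ioc.symm] at this

/-- The preimage of `f` is its periodization from `(0, 1]`, which differs from `(0, 1)` by a null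
set. Surjectivity transfers the density of continuous functions from the circle to the interval. -/
theorem surjective_compMeasurePreserving_volUnit {E : Type*} [NormedAddCommGroup E] (p : ℝ≥0∞) :
    Function.Surjective (Lp.compMeasurePreserving (E := E) (p := p)
      ((↑) : ℝ → UnitAddCircle) measurePreserving_coe_volUnit) := by
  intro f
  have hf : MemLp f p (volume.restrict (Ioc 0 (0 + 1))) := by
    rw [zero_add, Measure.restrict_congr_set Ioo_ae_eq_Ioc.symm]
    exact Lp.memLp f
  have hF : MemLp (AddCircle.liftIoc (1 : ℝ) 0 f) p (volume : Measure UnitAddCircle) :=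
    hf.comp_measurePreserving ((measurePreserving_subtype_coe measurableSet_Ioc).comp
      (AddCircle.measurePreserving_equivIoc (1 : ℝ)))
  refine ⟨hF.toLp _, Lp.ext ?_⟩
  rw [Lp.toLp_compMeasurePreserving hF]
  refine (MemLp.coeFn_toLp _).trans ?_
  filter_upwards [ae_restrict_mem measurableSet_Ioo] with t ht
  exact AddCircle.liftIoc_coe_apply (p := (1 : ℝ)) (a := 0) (by simpa using Ioo_subset_Ioc_self ht)

theorem exists_continuousMap_toLp_volUnit_denseRange (𝕜 : Type*) [RCLike 𝕜] (p : ℝ≥0∞)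
    [Fact (1 ≤ p)] (hp : p ≠ ∞) :
    ∃ Φ : C(UnitAddCircle, 𝕜) →L[𝕜] Lp 𝕜 p volUnit, DenseRange Φ ∧
      ∀ g : C(UnitAddCircle, 𝕜), Φ g =ᵐ[volUnit] fun t : ℝ => g (t : UnitAddCircle) := by
  refine ⟨(Lp.compMeasurePreservingₗᵢ 𝕜 _
    measurePreserving_coe_volUnit).toContinuousLinearMap.comp
      (ContinuousMap.toLp p (volume : Measure UnitAddCircle) 𝕜), ?_, fun g => ?_⟩
  · exact (surjective_compMeasurePreserving_volUnit p).denseRange.comp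
      (ContinuousMap.toLp_denseRange 𝕜 _ 𝕜 hp) (Lp.isometry_compMeasurePreserving measurePreserving_coe_volUnit).continuous
  · exact (Lp.coeFn_compMeasurePreserving _ measurePreserving_coe_volUnit).trans
      (measurePreserving_coe_volUnit.quasiMeasurePreserving.ae_eq_comp
        (ContinuousMap.coeFn_toLp _ g))

theorem continuous_cosPow (𝕜 : Type*) [RCLike 𝕜] (θ : ℝ) (n : ℕ) : Continuous (cosPow 𝕜 θ n) := by
  unfold cosPow
  fun_prop

theorem periodic_cosPow (𝕜 : Type*) [RCLike 𝕜] (θ : ℝ) (n : ℕ) :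
    Function.Periodic (cosPow 𝕜 θ n) 1 := by
  intro t
  simp only [cosPow]
  rw [show 2 * Real.pi * (t + 1 - θ) = 2 * Real.pi * (t - θ) + 2 * Real.pi by ring,
    Real.cos_add_two_pi]

theorem memLp_cosPow (𝕜 : Type*) [RCLike 𝕜] (p : ℝ≥0∞) (θ : ℝ) (n : ℕ) :
    MemLp (cosPow 𝕜 θ n) p volUnit := by
  have : IsFiniteMeasure volUnit := ⟨by simp [volUnit]⟩
  refine MemLp.of_bound (continuous_cosPow 𝕜 θ n).aestronglyMeasurable 1
    (Filter.Eventually.of_forall fun t => ?_)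
  rw [cosPow, RCLike.norm_ofReal, abs_pow]
  exact pow_le_one₀ (abs_nonneg _) (Real.abs_cos_le_one _)

theorem theorem4p10 {𝕜 : Type*} [RCLike 𝕜] (p : ℝ≥0∞) [Fact (1 ≤ p)] (θ₁ θ₂ : ℝ)
    (hθ : Irrational (θ₁ - θ₂)) (Λ Λ' : Set ℕ)
    (hΛ : IsMuntzSzaszSymm Λ) (hΛ' : IsMuntzSzaszSymm Λ') :
    IsTotalInX p ({f : ℝ → 𝕜 | ∃ n ∈ Λ, f = cosPow 𝕜 θ₁ n} ∪
      {f : ℝ → 𝕜 | ∃ n ∈ Λ', f = cosPow 𝕜 θ₂ n}) := by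
  set F := {f : ℝ → 𝕜 | ∃ n ∈ Λ, f = cosPow 𝕜 θ₁ n} ∪ {f : ℝ → 𝕜 | ∃ n ∈ Λ', f = cosPow 𝕜 θ₂ n}
    with hF
  have hdense : Dense (Submodule.span 𝕜
      {g : C(UnitAddCircle, 𝕜) | ∃ f ∈ F, ∀ t : ℝ, g (t : UnitAddCircle) = f t} :
      Set C(UnitAddCircle, 𝕜)) := by
    refine dense_span_of_ofReal_mem
      (topologicalClosure_span_circleCos_pow_eq_top hθ hΛ hΛ') ?_
    rintro _ (⟨n, hn, rfl⟩ | ⟨n, hn, rfl⟩)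
    · exact ⟨_, Or.inl ⟨n, hn, rfl⟩, fun t => by simp [cosPow]⟩
    · exact ⟨_, Or.inr ⟨n, hn, rfl⟩, fun t => by simp [cosPow]⟩
  refine ⟨fun hp => ⟨?_, ?_⟩, fun _ => ⟨?_, hdense⟩⟩
  · rintro _ (⟨n, -, rfl⟩ | ⟨n, -, rfl⟩) <;> exact memLp_cosPow 𝕜 p _ n
  · obtain ⟨Φ, hΦ, hΦcoe⟩ := exists_continuousMap_toLp_volUnit_denseRange 𝕜 p hp
    refine (hΦ.dense_image Φ.continuous hdense).mono ?_
    change (Submodule.map (Φ : C(UnitAddCircle, 𝕜) →ₗ[𝕜] Lp 𝕜 p volUnit) (Submodule.span 𝕜 _) :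
      Set (Lp 𝕜 p volUnit)) ⊆ _
    rw [Submodule.map_span]
    refine Submodule.span_mono ?_
    rintro _ ⟨g, ⟨f, hf, hgf⟩, rfl⟩
    exact ⟨f, hf, (hΦcoe g).trans (Filter.Eventually.of_forall hgf)⟩
  · rintro _ (⟨n, -, rfl⟩ | ⟨n, -, rfl⟩) <;>
      exact ⟨continuous_cosPow 𝕜 _ n, periodic_cosPow 𝕜 _ n⟩
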